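/- Let $G$ be a finite abelian group, written additively, let $n=|G|$, and let $S\subseteq G$ be a generating set of $G$ with $0_G\notin S$. Let $\mathrm{Cay}(G,S)$ be the directed Cayley graph with vertex set $G$ and an arc from $u$ to $v$ exactly when $v-u\in S$. Let $c(G,S)$ denote its cop number, that is, the least number $k$ such that $k$ cops have a winning strategy in the following game with perfect information. The cops are placed on vertices (several cops may share a vertex), then the robber is placed on a vertex, and then the cops and the robber alternate turns, the cops first; on a turn, each cop (respectively the robber) either stays or moves along one arc in its direction. The cops win if at some moment a cop occupies the same vertex as the robber, and the robber wins if he avoids this forever. Let $p$ be the smallest prime factor of $n$. 1. If $p=3$, then $c(G,S)\le \sqrt{\dfrac{3}{(\sqrt3-1)\,e}}\,\sqrt n+2$, where $\sqrt{\frac{3}{(\sqrt3-1)e}}\approx 1.2278$. 2. If $p\ge 5$, then $c(G,S)\le \dfrac{2}{\sqrt e}\,\sqrt n+2$, where $\frac{2}{\sqrt e}\approx 1.2131$. The approximations are correct to four decimal places. -/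

import Mathlib

namespace CopsRobbers

/-- The Cayley digraph of an additive group `G` with connection set `S`:
there is an arc from `u` to `v` if and only if `v - u ∈ S`. -/
def cayleyDigraph (G : Type*) [AddGroup G] (S : Set G) : Digraph G where
  Adj u v := v - u ∈ S

/-- A legal move of a cop or of the robber in the game played on the digraph `D`: stay at the
current vertex, or follow an arc in its own direction. -/
def Move {V : Type*} (D : Digraph V) (u v : V) : Prop :=
  u = v ∨ D.Adj u v

/-- A strategy for `k` cops on the digraph `D`. The list `h` records the vertices that the robber
has occupied so far, most recent one first, and `pos h` are the positions of the cops after they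
have reacted to `h`. So `pos []` is their initial placement, which is chosen before the robber
appears, and seeing the robber at the new vertex `r` the cops move from `pos h` to `pos (r :: h)`.
Several cops may occupy the same vertex. -/
structure CopStrategy {V : Type*} (D : Digraph V) (k : ℕ) where
  /-- The positions of the cops as a function of the history of the robber. -/
  pos : List V → Fin k → V
  /-- All the moves of the cops are legal. -/
  legal : ∀ (h : List V) (r : V) (i : Fin k), Move D (pos h i) (pos (r :: h) i)

/-- The history of a robber who visits `r 0, r 1, …`, just before he occupies `r t`:
the list `[r (t - 1), …, r 1, r 0]`. -/
def history {V : Type*} (r : ℕ → V) : ℕ → List V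
  | 0 => []
  | t + 1 => r t :: history r t

/-- The strategy is winning if it captures every robber who moves legally. In a play the cops are
placed, the robber is placed at `r 0`, and then the cops and the robber take turns; the robber
occupies `r t` after his `t`-th move. At some time a cop must be at the vertex of the robber, either
because the robber has moved to (or started at) the vertex of the cop, or because the cop has moved
to the vertex of the robber. -/
def CopStrategy.IsWinning {V : Type*} {D : Digraph V} {k : ℕ} (σ : CopStrategy D k) : Prop :=
  ∀ r : ℕ → V, (∀ t, Move D (r t) (r (t + 1))) →
    ∃ (t : ℕ) (i : Fin k), σ.pos (history r t) i = r t ∨ σ.pos (history r (t + 1)) i = r t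

/-- `k` cops have a winning strategy on `D`. -/
def CopsWin {V : Type*} (D : Digraph V) (k : ℕ) : Prop :=
  ∃ σ : CopStrategy D k, σ.IsWinning

/-- The cop number of `D`: the least number of cops that have a winning strategy. -/
noncomputable def copNumber {V : Type*} (D : Digraph V) : ℕ :=
  sInf {k : ℕ | CopsWin D k}

/-- On a finite digraph the cop number is attained, since a cop at every vertex wins. -/
theorem copsWin_copNumber {V : Type*} [Finite V] (D : Digraph V) : CopsWin D (copNumber D) := by
  have h : CopsWin D (Nat.card V) := by
    refine ⟨⟨fun _ i => (Finite.equivFin V).symm i, fun _ _ _ => Or.inl rfl⟩, ?_⟩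
    intro r _
    exact ⟨0, Finite.equivFin V (r 0), Or.inl (by simp)⟩
  exact Nat.sInf_mem (s := {k : ℕ | CopsWin D k}) ⟨_, h⟩

end CopsRobbers

/-! ### The game on differences -/

namespace CopsRobbers

/-! Follow, for each cop, the difference robber minus cop: a move `s` answered by `t` changes it by
`s - t`. Let `M = S ∪ {0}`. A cop whose difference lies in `⟨δ⟩` can answer every `s` with `s - δ ∈
M` by `s - δ`, advancing by `δ`. A cop at any position can guard one single move, because `M`
generates `G`. Cops mimic the moves they do not guard, so once every move has a guard, a sum of
potentials drops until a capture (`reach_captured_of_guards`).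

Averaging yields `m` nonzero shifts that leave at most `(n - 1)/(m e)` nonzero moves unguarded
(`exists_shifts`, `mul_one_sub_div_pow_le`); each of these, and the move `0`, gets its own cop.
Bringing a difference into `⟨δ⟩` means winning on `G ⧸ ⟨δ⟩`, whose order is at most `u² n` if all
prime factors of `n` are at least `1/u²`; induction on `n` provides this (`reach_forall_mem`).
Besides the `m` guards, both tasks need about `c u √n` cops, which is consistent when `c² u (1 - u)
e ≥ 1` (`alwaysWin_of_lt`). -/

/-- The cops can force the game on differences (robber minus cop) with the set `M` of moves from
the differences `d`, the robber being to move, into a position that satisfies `goal`. -/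
inductive Reach {G ι : Type*} [AddCommGroup G] (M : Set G) (goal : (ι → G) → Prop) :
    (ι → G) → Prop
  | done (d : ι → G) (h : goal d) : Reach M goal d
  | step (d : ι → G) (t : G → ι → G) (ht : ∀ s ∈ M, ∀ i, t s i ∈ M)
      (h : ∀ s ∈ M, Reach M goal (fun i => d i + s - t s i)) : Reach M goal d

/-- The cops can force a position that satisfies `goal` within the given number of rounds. -/
def ReachIn {G ι : Type*} [AddCommGroup G] (M : Set G) (goal : (ι → G) → Prop) :
    ℕ → (ι → G) → Prop
  | 0, d => goal d
  | n + 1, d => goal d ∨ ∀ s ∈ M, ∃ t : ι → G, (∀ i, t i ∈ M) ∧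
      ReachIn M goal n (fun i => d i + s - t i)

section Game

variable {G ι : Type*} [AddCommGroup G] {M : Set G}

theorem Reach.of_forall_exists {goal : (ι → G) → Prop} {d : ι → G}
    (h : ∀ s ∈ M, ∃ t : ι → G, (∀ i, t i ∈ M) ∧ Reach M goal (fun i => d i + s - t i)) :
    Reach M goal d := by
  choose! t ht h using h
  exact .step d t ht h

theorem ReachIn.succ {goal : (ι → G) → Prop} {n : ℕ} {d : ι → G} (h : ReachIn M goal n d) :
    ReachIn M goal (n + 1) d := by
  induction n generalizing d with
  | zero => exact Or.inl h
  | succ n ih =>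
    rcases h with h | h
    · exact Or.inl h
    · refine Or.inr fun s hs => ?_
      obtain ⟨t, ht, h⟩ := h s hs
      exact ⟨t, ht, ih h⟩

theorem ReachIn.mono {goal : (ι → G) → Prop} {m n : ℕ} (hmn : m ≤ n) {d : ι → G}
    (h : ReachIn M goal m d) : ReachIn M goal n d := by
  induction hmn with
  | refl => exact h
  | step _ ih => exact ih.succ

/-- The robber has finitely many moves, so the bounds after each of them have a common upper bound.
-/
theorem Reach.exists_reachIn [Finite G] {goal : (ι → G) → Prop} {d : ι → G}
    (h : Reach M goal d) : ∃ n, ReachIn M goal n d := by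
  induction h with
  | done d h => exact ⟨0, h⟩
  | step d t ht _ ih =>
    have key : ∀ s : G, ∃ n, s ∈ M → ∃ t : ι → G, (∀ i, t i ∈ M) ∧
        ReachIn M goal n (fun i => d i + s - t i) := by
      intro s
      by_cases hs : s ∈ M
      · obtain ⟨n, hn⟩ := ih s hs
        exact ⟨n, fun _ => ⟨t s, ht s hs, hn⟩⟩
      · exact ⟨0, fun h => absurd h hs⟩
    choose n hn using key
    obtain ⟨N, hN⟩ := (Set.finite_range n).bddAbove
    refine ⟨N + 1, Or.inr fun s hs => ?_⟩
    obtain ⟨t, ht, h⟩ := hn s hs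
    exact ⟨t, ht, h.mono (hN ⟨s, rfl⟩)⟩

theorem Reach.trans {goal goal' : (ι → G) → Prop} {d : ι → G} (h : Reach M goal d)
    (h' : ∀ d, goal d → Reach M goal' d) : Reach M goal' d := by
  induction h with
  | done d h => exact h' d h
  | step d t ht _ ih => exact .step d t ht ih

theorem Reach.mono {goal goal' : (ι → G) → Prop} {d : ι → G} (h : Reach M goal d)
    (h' : ∀ d, goal d → goal' d) : Reach M goal' d :=
  h.trans fun d hd => .done d (h' d hd)

/-- Cops outside of the range of `e` mimic the robber. -/
theorem Reach.extend {κ : Type*} (e : κ ↪ ι) {goal : (κ → G) → Prop} {d' : κ → G}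
    (h : Reach M goal d') (d : ι → G) (hd : ∀ j, d (e j) = d' j) :
    Reach M (fun x : ι → G => goal (fun j => x (e j)) ∧ ∀ i ∉ Set.range e, x i = d i) d := by
  classical
  suffices H : ∀ y : ι → G, (∀ j, y (e j) = d' j) → (∀ i ∉ Set.range e, y i = d i) →
      Reach M (fun x : ι → G => goal (fun j => x (e j)) ∧ ∀ i ∉ Set.range e, x i = d i) y from
    H d hd fun _ _ => rfl
  clear hd
  induction h with
  | done d' h =>
    intro y hy hy'
    refine .done _ ⟨?_, hy'⟩
    rwa [show (fun j => y (e j)) = d' from funext hy]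
  | step d' t ht _ ih =>
    intro y hy hy'
    refine .of_forall_exists fun s hs => ?_
    refine ⟨fun i => if hi : i ∈ Set.range e then t s hi.choose else s, ?_, ih s hs _ ?_ ?_⟩
    · intro i
      dsimp only
      split_ifs
      · exact ht s hs _
      · exact hs
    · intro j
      have hj : e j ∈ Set.range e := ⟨j, rfl⟩
      have : hj.choose = j := e.injective hj.choose_spec
      simp only [dif_pos hj, this, hy]
    · intro i hi
      simp only [dif_neg hi, hy' i hi, add_sub_cancel_right]

/-- Each reply in the image is played in `G` through an arbitrary preimage in `M`. -/
theorem Reach.lift {Q : Type*} [AddCommGroup Q] (f : G →+ Q) {goal : (ι → Q) → Prop}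
    {e : ι → Q} (h : Reach (f '' M) goal e) (d : ι → G) (hd : ∀ i, f (d i) = e i) :
    Reach M (fun x : ι → G => goal (fun i => f (x i))) d := by
  induction h generalizing d with
  | done e h =>
    refine .done _ ?_
    rwa [show (fun i => f (d i)) = e from funext hd]
  | step e t ht _ ih =>
    refine .of_forall_exists fun s hs => ?_
    choose t' ht' hft using ht (f s) ⟨s, hs, rfl⟩
    exact ⟨t', ht', ih (f s) ⟨s, hs, rfl⟩ _ fun i => by simp [hd, hft]⟩

end Game

/-- Some cop is at the vertex of the robber. -/
def Captured {G ι : Type*} [AddCommGroup G] (d : ι → G) : Prop := ∃ i, d i = 0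

/-- With the moves `M`, `k` cops capture the robber from every position. -/
def AlwaysWin {G : Type*} [AddCommGroup G] (M : Set G) (k : ℕ) : Prop :=
  ∀ d : Fin k → G, Reach M Captured d

/-! ### From forced positions to cop strategies -/

section Strategy

variable {G : Type*} [AddCommGroup G]

/-- Aiming at the least attainable bound gives one response that works for every `n`, so the
strategy needs no clock. -/
theorem exists_response (M : Set G) (h0 : (0 : G) ∈ M) {k : ℕ} (goal : (Fin k → G) → Prop) :
    ∃ τ : (Fin k → G) → G → Fin k → G, (∀ d s i, τ d s i ∈ M) ∧
      ∀ n d s, s ∈ M → ReachIn M goal (n + 1) d → ¬ goal d →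
        ReachIn M goal n (fun i => d i + s - τ d s i) := by
  classical
  have key : ∀ (d : Fin k → G) (s : G), ∃ t : Fin k → G, (∀ i, t i ∈ M) ∧
      ∀ n, s ∈ M → ReachIn M goal (n + 1) d → ¬ goal d →
        ReachIn M goal n (fun i => d i + s - t i) := by
    intro d s
    by_cases h : ∃ n, ∃ t : Fin k → G, (∀ i, t i ∈ M) ∧
        ReachIn M goal n (fun i => d i + s - t i)
    · obtain ⟨t, ht, hn⟩ := Nat.find_spec h
      refine ⟨t, ht, fun n hs hd hg => hn.mono (Nat.find_min' h ?_)⟩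
      exact (hd.resolve_left hg) s hs
    · exact ⟨fun _ => 0, fun _ => h0, fun n hs hd hg =>
        absurd ⟨n, (hd.resolve_left hg) s hs⟩ h⟩
  choose τ h1 h2 using key
  exact ⟨τ, h1, fun n d s => h2 d s n⟩

/-- The positions of cops who wait at `0` until the robber appears and then follow `τ`. -/
def positions {k : ℕ} (τ : (Fin k → G) → G → Fin k → G) : List G → Fin k → G
  | [] => 0
  | [_] => 0
  | r :: r' :: h => fun i => positions τ (r' :: h) i +
      τ (fun j => r' - positions τ (r' :: h) j) (r - r') i

theorem AlwaysWin.copsWin [Finite G] {S : Set G} {k : ℕ} (h : AlwaysWin (insert 0 S) k) :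
    CopsWin (cayleyDigraph G S) k := by
  obtain ⟨τ, hτM, hτ⟩ := exists_response (insert 0 S) (Set.mem_insert 0 S) (k := k) Captured
  refine ⟨⟨positions τ, ?_⟩, ?_⟩
  · intro h r i
    rcases h with _ | ⟨r', h⟩
    · exact Or.inl rfl
    · rcases hτM (fun j => r' - positions τ (r' :: h) j) (r - r') i with h0 | h1
      · left; simp [positions, h0]
      · right; simpa [positions, cayleyDigraph] using h1
  · intro r hr
    have main : ∀ n t, ReachIn (insert 0 S) Captured n
        (fun i => r t - positions τ (history r (t + 1)) i) →
        ∃ t', Captured (fun i => r t' - positions τ (history r (t' + 1)) i) := by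
      intro n
      induction n with
      | zero => exact fun t ht => ⟨t, ht⟩
      | succ n ih =>
        intro t ht
        by_cases hc : Captured (fun i => r t - positions τ (history r (t + 1)) i)
        · exact ⟨t, hc⟩
        · apply ih (t + 1)
          have hs : r (t + 1) - r t ∈ insert 0 S := by
            rcases hr t with h | h
            · left; rw [h, sub_self]
            · right; exact h
          convert hτ n _ _ hs ht hc using 2 with i
          simp only [history, positions]
          abel
    obtain ⟨n, hn⟩ := (h (fun i => r 0 - positions τ (history r 1) i)).exists_reachIn
    obtain ⟨t, i, hi⟩ := main n 0 hn
    exact ⟨t, i, Or.inr (sub_eq_zero.1 hi).symm⟩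

end Strategy

/-! ### Guarding sets of robber moves -/

section Guards

variable {G ι : Type*} [AddCommGroup G] {M : Set G}

/-- A cop whose difference is in `X` can stay in `X` and make progress towards the robber whenever
the robber plays a move in `A`. -/
def Guards (M A X : Set G) : Prop :=
  ∃ φ : G → ℕ, ∀ d ∈ X, d ≠ 0 → ∀ s ∈ A, ∃ t ∈ M, d + s - t ∈ X ∧ φ (d + s - t) < φ d

/-- The differences that become `0` when the given number of elements of `Γ` is added. -/
def level (Γ : Set G) : ℕ → Set G
  | 0 => {0}
  | n + 1 => {d | ∃ γ ∈ Γ, d + γ ∈ level Γ n}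

theorem exists_mem_level [Finite G] {Γ : Set G} {d : G} (hd : d ∈ AddSubgroup.closure Γ) :
    ∃ n, d ∈ level Γ n := by
  -- In a finite group, inverses are sums of generators, so steps in `Γ` alone suffice.
  have h : -d ∈ AddSubmonoid.closure Γ := by
    rw [← AddSubgroup.closure_toAddSubmonoid_of_finite]
    exact AddSubgroup.neg_mem _ hd
  suffices H : ∀ x ∈ AddSubmonoid.closure Γ, ∃ n, -x ∈ level Γ n by simpa using H _ h
  intro x hx
  induction hx using AddSubmonoid.closure_induction_left with
  | zero => exact ⟨0, by simp [level]⟩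
  | add_left γ hγ y _ ih =>
    obtain ⟨n, hn⟩ := ih
    exact ⟨n + 1, γ, hγ, by simpa using hn⟩

/-- The reply `s - γ` adds `γ` to the difference; the potential is the least number of elements of
`Γ` summing to `-d`. -/
theorem guards_closure [Finite G] (M Γ : Set G) :
    Guards M {s | ∀ γ ∈ Γ, s - γ ∈ M} (AddSubgroup.closure Γ) := by
  classical
  refine ⟨fun d => sInf {n | d ∈ level Γ n}, fun d hd hd0 s hs => ?_⟩
  have hmem : d ∈ level Γ (sInf {n | d ∈ level Γ n}) := Nat.sInf_mem (exists_mem_level hd)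
  rcases hn : sInf {n | d ∈ level Γ n} with _ | n
  · rw [hn] at hmem
    exact absurd hmem hd0
  · rw [hn] at hmem
    obtain ⟨γ, hγ, h⟩ := hmem
    have e : d + s - (s - γ) = d + γ := by abel
    refine ⟨s - γ, hs γ hγ, ?_, ?_⟩
    · rw [e]
      exact add_mem hd (AddSubgroup.subset_closure hγ)
    · rw [e]
      dsimp only
      rw [hn]
      exact Nat.lt_succ_of_le (Nat.sInf_le (s := {n | d + γ ∈ level Γ n}) h)

theorem guards_zmultiples [Finite G] (M : Set G) (δ : G) :
    Guards M {s | s - δ ∈ M} (AddSubgroup.zmultiples δ) := by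
  simpa [AddSubgroup.zmultiples_eq_closure] using guards_closure M {δ}

/-- Take `Γ = u - M`: it contains `u` since `0 ∈ M`, hence generates all of `M`. -/
theorem guards_singleton [Finite G] {M : Set G} (h0 : (0 : G) ∈ M)
    (hM : AddSubgroup.closure M = ⊤) (u : G) : Guards M {u} Set.univ := by
  have hc : AddSubgroup.closure ((fun t => u - t) '' M) = ⊤ := by
    rw [eq_top_iff, ← hM, AddSubgroup.closure_le]
    intro t ht
    have h1 : u ∈ AddSubgroup.closure ((fun t => u - t) '' M) :=
      AddSubgroup.subset_closure ⟨0, h0, sub_zero u⟩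
    have h2 : u - t ∈ AddSubgroup.closure ((fun t => u - t) '' M) :=
      AddSubgroup.subset_closure ⟨t, ht, rfl⟩
    simpa using sub_mem h1 h2
  obtain ⟨φ, h⟩ := guards_closure M ((fun t => u - t) '' M)
  refine ⟨φ, fun d _ hd s hs => ?_⟩
  obtain ⟨t, ht, -, hlt⟩ := h d (by simp [hc]) hd s (by
    rintro _ ⟨t, ht, rfl⟩
    rw [Set.mem_singleton_iff.1 hs]
    simpa using ht)
  exact ⟨t, ht, trivial, hlt⟩

theorem guards_empty (M : Set G) : Guards M ∅ Set.univ :=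
  ⟨fun _ => 0, fun _ _ _ _ hs => absurd hs (Set.notMem_empty _)⟩

theorem reach_captured_of_guards [Finite ι] {A X : ι → Set G}
    (hG : ∀ i, Guards M (A i) (X i)) (hcov : ∀ s ∈ M, ∃ i, s ∈ A i) {d : ι → G}
    (hd : ∀ i, d i ∈ X i) : Reach M Captured d := by
  classical
  have := Fintype.ofFinite ι
  choose φ hφ using hG
  induction hN : ∑ i, φ i (d i) using Nat.strong_induction_on generalizing d with
  | _ N ih =>
    by_cases hc : Captured d
    · exact .done _ hc
    refine .of_forall_exists fun s hs => ?_
    obtain ⟨i, hi⟩ := hcov s hs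
    obtain ⟨t, ht, htX, hlt⟩ := hφ i (d i) (hd i) (fun h => hc ⟨i, h⟩) s hi
    have hval : ∀ j, d j + s - Function.update (fun _ => s) i t j =
        if j = i then d i + s - t else d j := by
      intro j
      by_cases hj : j = i
      · subst hj; simp
      · simp [hj]
    refine ⟨Function.update (fun _ => s) i t, fun j => ?_, ih _ ?_ (fun j => ?_) rfl⟩
    · by_cases hj : j = i
      · subst hj; simpa using ht
      · simpa [hj] using hs
    · rw [← hN]
      refine Finset.sum_lt_sum (fun j _ => ?_) ⟨i, Finset.mem_univ i, ?_⟩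
      · rw [hval]
        split_ifs with hj
        · subst hj; exact hlt.le
        · exact le_rfl
      · rw [hval, if_pos rfl]; exact hlt
    · rw [hval]
      split_ifs with hj
      · subst hj; exact htX
      · exact hd j

end Guards

/-! ### Bringing the cops into their subgroups -/

section Gathering

variable {G : Type*} [AddCommGroup G] {M : Set G}

theorem AlwaysWin.reach_mem {H : AddSubgroup G} {r : ℕ}
    (h : AlwaysWin (QuotientAddGroup.mk' H '' M) r) {ι : Type*} (e : Fin r ↪ ι) (d : ι → G) :
    Reach M (fun x : ι → G => (∃ j, x (e j) ∈ H) ∧ ∀ i ∉ Set.range e, x i = d i) d := by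
  refine (((h fun j => QuotientAddGroup.mk' H (d (e j))).lift (QuotientAddGroup.mk' H)
    (fun j => d (e j)) fun _ => rfl).extend e d fun _ => rfl).mono ?_
  rintro x ⟨⟨j, hj⟩, hx⟩
  exact ⟨⟨j, (QuotientAddGroup.eq_zero_iff _).1 hj⟩, hx⟩

/-- Cops are placed one at a time while those already placed mimic the robber. The last recruitment
has `m - 1` cops placed and needs `r` free ones, whence `k + 1`. -/
theorem reach_forall_mem (δ : ℕ → G) {r k m : ℕ} (hm : m + r ≤ k + 1)
    (h : ∀ i < m, AlwaysWin (QuotientAddGroup.mk' (AddSubgroup.zmultiples (δ i)) '' M) r)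
    (hk : 0 < k) (d : Fin k → G) :
    Reach M (fun x : Fin k → G => ∃ f : ℕ → Fin k, Set.InjOn f (Set.Iio m) ∧
      ∀ i < m, x (f i) ∈ AddSubgroup.zmultiples (δ i)) d := by
  classical
  induction m with
  | zero => exact .done _ ⟨fun _ => ⟨0, hk⟩, by simp, by simp⟩
  | succ m ih =>
    refine (ih (by omega) fun i hi => h i (by omega)).trans ?_
    rintro x ⟨f, hf, hx⟩
    have hcard : r ≤ Fintype.card {i // i ∉ (Finset.range m).image f} := by
      rw [Fintype.card_subtype_compl, Fintype.card_fin, Fintype.card_coe]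
      have := Finset.card_image_le (s := Finset.range m) (f := f)
      rw [Finset.card_range] at this
      omega
    obtain ⟨e⟩ : Nonempty (Fin r ↪ {i // i ∉ (Finset.range m).image f}) :=
      Function.Embedding.nonempty_of_card_le (by simpa using hcard)
    have hne : ∀ j, ∀ i < m, f i ≠ (e j).1 := fun j i hi he =>
      (e j).2 (Finset.mem_image.2 ⟨i, Finset.mem_range.2 hi, he⟩)
    refine ((h m (by omega)).reach_mem (e.trans (Function.Embedding.subtype _)) x).mono ?_
    rintro y ⟨⟨j, hj⟩, hy⟩
    refine ⟨Function.update f m (e j), ?_, ?_⟩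
    · intro a ha b hb hab
      simp only [Set.mem_Iio] at ha hb
      rcases Nat.lt_succ_iff_lt_or_eq.1 ha with ha | rfl <;>
      rcases Nat.lt_succ_iff_lt_or_eq.1 hb with hb | rfl
      · rw [Function.update_of_ne ha.ne, Function.update_of_ne hb.ne] at hab
        exact hf ha hb hab
      · rw [Function.update_of_ne ha.ne, Function.update_self] at hab
        exact absurd hab (hne j a ha)
      · rw [Function.update_of_ne hb.ne, Function.update_self] at hab
        exact absurd hab.symm (hne j b hb)
      · rfl
    · intro i hi
      rcases Nat.lt_succ_iff_lt_or_eq.1 hi with hi | rfl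
      · rw [Function.update_of_ne hi.ne, hy]
        · exact hx i hi
        · rintro ⟨l, hl⟩
          exact hne l i hi hl.symm
      · simpa using hj

theorem reach_captured_of_mem [Finite G] (h0 : (0 : G) ∈ M) (hM : AddSubgroup.closure M = ⊤)
    (δ : ℕ → G) {k m : ℕ} (U : Finset G)
    (hU : ∀ s ∈ M, s ∈ U ∨ ∃ i < m, s - δ i ∈ M) (hcard : m + U.card ≤ k)
    {f : ℕ → Fin k} (hf : Set.InjOn f (Set.Iio m)) {d : Fin k → G}
    (hd : ∀ i < m, d (f i) ∈ AddSubgroup.zmultiples (δ i)) : Reach M Captured d := by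
  classical
  have hc : Fintype.card U ≤ Fintype.card {i // i ∉ (Finset.range m).image f} := by
    rw [Fintype.card_subtype_compl, Fintype.card_fin, Fintype.card_coe, Fintype.card_coe]
    have := Finset.card_image_le (s := Finset.range m) (f := f)
    rw [Finset.card_range] at this
    omega
  obtain ⟨e⟩ : Nonempty (U ↪ {i // i ∉ (Finset.range m).image f}) :=
    Function.Embedding.nonempty_of_card_le hc
  have key : ∀ i : Fin k, ∃ A X : Set G, Guards M A X ∧ d i ∈ X ∧
      (∀ a < m, f a = i → {s | s - δ a ∈ M} ⊆ A) ∧ ∀ u : U, (e u).1 = i → u.1 ∈ A := by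
    intro i
    by_cases h1 : ∃ a < m, f a = i
    · obtain ⟨a, ha, rfl⟩ := h1
      refine ⟨_, _, guards_zmultiples M (δ a), hd a ha, ?_, ?_⟩
      · intro b hb hba
        rw [hf hb ha hba]
      · intro u hu
        exact absurd (Finset.mem_image.2 ⟨a, Finset.mem_range.2 ha, hu.symm⟩) (e u).2
    · by_cases h2 : ∃ u : U, (e u).1 = i
      · obtain ⟨u, rfl⟩ := h2
        refine ⟨_, _, guards_singleton h0 hM u.1, trivial, ?_, ?_⟩
        · exact fun a ha hai => absurd ⟨a, ha, hai⟩ h1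
        · intro v hv
          rw [e.injective (Subtype.ext hv)]
          rfl
      · exact ⟨_, _, guards_empty M, trivial, fun a ha hai => absurd ⟨a, ha, hai⟩ h1,
          fun u hu => absurd ⟨u, hu⟩ h2⟩
  choose A X hG hX hA hAU using key
  refine reach_captured_of_guards hG (fun s hs => ?_) hX
  rcases hU s hs with h | ⟨a, ha, h⟩
  · exact ⟨_, hAU _ ⟨s, h⟩ rfl⟩
  · exact ⟨_, hA _ a ha rfl h⟩

end Gathering

/-! ### Greedy choice of shifts -/

section Averaging

variable {G : Type*} [AddCommGroup G] [Fintype G] [DecidableEq G]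

/-- Double counting: each `s ∈ U` has `s - δ ∈ M` for exactly `|M| - 1` nonzero `δ`. -/
theorem exists_ne_zero_card_mul_le [Nontrivial G] {M U : Finset G} (hUM : U ⊆ M) :
    ∃ δ : G, δ ≠ 0 ∧ U.card * (M.card - 1) ≤
      (Fintype.card G - 1) * (U.filter fun s => s - δ ∈ M).card := by
  by_contra! hcon
  have hsum : ∑ δ ∈ Finset.univ.erase (0 : G), (U.filter fun s => s - δ ∈ M).card =
      U.card * (M.card - 1) := by
    refine (Finset.sum_card_bipartiteAbove_eq_sum_card_bipartiteBelow
      (fun δ s => s - δ ∈ M)).trans ?_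
    rw [Finset.sum_const_nat (m := M.card - 1)]
    intro s hs
    rw [← Finset.card_erase_of_mem (hUM hs)]
    refine Finset.card_bij' (fun δ _ => s - δ) (fun t _ => s - t) ?_ ?_ ?_ ?_
    · intro δ hδ
      simp [Finset.bipartiteBelow] at hδ ⊢
      exact hδ
    · intro t ht
      simp [Finset.bipartiteBelow, sub_eq_zero] at ht ⊢
      exact ⟨fun h => ht.1 h.symm, ht.2⟩
    · intro δ _; simp
    · intro t _; simp
  have hcard : (Finset.univ.erase (0 : G)).card = Fintype.card G - 1 := by
    rw [Finset.card_erase_of_mem (Finset.mem_univ _), Finset.card_univ]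
  have hne : (Finset.univ.erase (0 : G)).Nonempty := by
    obtain ⟨x, hx⟩ := exists_ne (0 : G)
    exact ⟨x, by simpa using hx⟩
  have := Finset.sum_lt_sum_of_nonempty hne fun δ hδ => hcon δ (Finset.ne_of_mem_erase hδ)
  rw [← Finset.mul_sum, hsum, Finset.sum_const, hcard, smul_eq_mul] at this
  exact lt_irrefl _ this

theorem exists_shifts [Nontrivial G] {M : Finset G} (h0 : (0 : G) ∈ M) (m : ℕ) :
    ∃ δ : ℕ → G, (∀ i < m, δ i ≠ 0) ∧
      (((M.erase 0).filter fun s => ∀ i < m, s - δ i ∉ M).card : ℝ) ≤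
        (M.card - 1 : ℝ) * (1 - (M.card - 1 : ℝ) / (Fintype.card G - 1)) ^ m := by
  have hMc : 1 ≤ M.card := Finset.card_pos.2 ⟨0, h0⟩
  have hGc : 1 < Fintype.card G := Fintype.one_lt_card
  have hG' : (0 : ℝ) < (Fintype.card G : ℝ) - 1 := by
    have : (1 : ℝ) < Fintype.card G := by exact_mod_cast hGc
    linarith
  have hMG : (M.card : ℝ) ≤ Fintype.card G := by exact_mod_cast Finset.card_le_univ M
  induction m with
  | zero =>
    refine ⟨fun _ => 0, by simp, ?_⟩
    simp [Finset.card_erase_of_mem h0, Nat.cast_sub hMc]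
  | succ m ih =>
    obtain ⟨δ, hδ, hb⟩ := ih
    set U := (M.erase 0).filter fun s => ∀ i < m, s - δ i ∉ M with hU
    obtain ⟨ε, hε, hle⟩ := exists_ne_zero_card_mul_le (M := M) (U := U)
      ((Finset.filter_subset _ _).trans (Finset.erase_subset _ _))
    refine ⟨Function.update δ m ε, ?_, ?_⟩
    · intro i hi
      rcases Nat.lt_succ_iff_lt_or_eq.1 hi with hi | rfl
      · rw [Function.update_of_ne hi.ne]; exact hδ i hi
      · simpa using hε
    · have hset : ((M.erase 0).filter fun s => ∀ i < m + 1, s - Function.update δ m ε i ∉ M) =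
          U.filter fun s => ¬ (s - ε ∈ M) := by
        rw [hU, Finset.filter_filter]
        refine Finset.filter_congr fun s _ => ?_
        rw [Nat.forall_lt_succ_right]
        refine and_congr (forall₂_congr fun i hi => ?_) (by simp)
        rw [Function.update_of_ne hi.ne]
      rw [hset]
      have hsplit := Finset.card_filter_add_card_filter_not (s := U) (fun s => s - ε ∈ M)
      have hsplit' : ((U.filter fun s => s - ε ∈ M).card : ℝ) +
          (U.filter fun s => ¬ (s - ε ∈ M)).card = U.card := by exact_mod_cast hsplit
      have hle' : (U.card : ℝ) * (M.card - 1) ≤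
          (Fintype.card G - 1) * (U.filter fun s => s - ε ∈ M).card := by
        have := (Nat.cast_le (α := ℝ)).2 hle
        rwa [Nat.cast_mul, Nat.cast_mul, Nat.cast_sub hMc, Nat.cast_sub hGc.le,
          Nat.cast_one] at this
      have hq : (U.card : ℝ) * ((M.card - 1) / (Fintype.card G - 1)) ≤
          (U.filter fun s => s - ε ∈ M).card := by
        rw [← mul_div_assoc, div_le_iff₀ hG']
        linarith
      have hnn : 0 ≤ 1 - (M.card - 1 : ℝ) / (Fintype.card G - 1) := by
        rw [sub_nonneg, div_le_one hG']
        linarith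
      calc ((U.filter fun s => ¬ (s - ε ∈ M)).card : ℝ)
          ≤ U.card * (1 - (M.card - 1 : ℝ) / (Fintype.card G - 1)) := by linarith
        _ ≤ _ := by
          rw [pow_succ, ← mul_assoc]
          exact mul_le_mul_of_nonneg_right hb hnn

end Averaging

/-! ### Estimates and the induction on the order of the group -/

theorem mul_one_sub_div_pow_le {x N : ℝ} {m : ℕ} (hN : 0 < N) (hm : 0 < m) (hxN : x ≤ N) :
    x * (1 - x / N) ^ m ≤ N / (m * Real.exp 1) := by
  have hm' : (0 : ℝ) < m := by exact_mod_cast hm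
  have hnn : 0 ≤ 1 - x / N := by
    rw [sub_nonneg, div_le_one hN]; exact hxN
  rcases le_or_gt x 0 with hx | hx
  · exact (mul_nonpos_of_nonpos_of_nonneg hx (pow_nonneg hnn m)).trans (by positivity)
  have h1 : (1 - x / N) ^ m ≤ Real.exp (-(m * x / N)) := by
    calc (1 - x / N) ^ m ≤ Real.exp (-(x / N)) ^ m :=
          pow_le_pow_left₀ hnn (by linarith [Real.add_one_le_exp (-(x / N))]) m
      _ = Real.exp (-(m * x / N)) := by
          rw [← Real.exp_nat_mul]; congr 1; ring
  -- This is `y e^{-y} ≤ 1/e` at `y = m x / N`.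
  have h2 : m * x / N * Real.exp (-(m * x / N)) * Real.exp 1 ≤ 1 := by
    have h := Real.add_one_le_exp (m * x / N - 1)
    rw [mul_assoc, ← Real.exp_add]
    calc m * x / N * Real.exp (-(m * x / N) + 1)
        ≤ Real.exp (m * x / N - 1) * Real.exp (-(m * x / N) + 1) :=
          mul_le_mul_of_nonneg_right (by linarith) (Real.exp_pos _).le
      _ = 1 := by rw [← Real.exp_add]; simp
  calc x * (1 - x / N) ^ m ≤ x * Real.exp (-(m * x / N)) :=
        mul_le_mul_of_nonneg_left h1 hx.le
    _ = m * x / N * Real.exp (-(m * x / N)) * Real.exp 1 * (N / (m * Real.exp 1)) := by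
        field_simp
    _ ≤ 1 * (N / (m * Real.exp 1)) := mul_le_mul_of_nonneg_right h2 (by positivity)
    _ = _ := one_mul _

/-- The order of `δ` has a prime factor, which is at least `1/u²`. -/
theorem card_quotient_zmultiples_le {G : Type*} [AddCommGroup G] [Finite G] {u : ℝ}
    (hq : ∀ q : ℕ, q.Prime → q ∣ Nat.card G → 1 ≤ u ^ 2 * q) {δ : G} (hδ : δ ≠ 0) :
    (Nat.card (G ⧸ AddSubgroup.zmultiples δ) : ℝ) ≤ u ^ 2 * Nat.card G ∧
      Nat.card (G ⧸ AddSubgroup.zmultiples δ) < Nat.card G ∧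
      Nat.card (G ⧸ AddSubgroup.zmultiples δ) ∣ Nat.card G := by
  have hmul := AddSubgroup.card_eq_card_quotient_mul_card_addSubgroup (AddSubgroup.zmultiples δ)
  rw [Nat.card_zmultiples] at hmul
  have hne : addOrderOf δ ≠ 1 := by rwa [Ne, AddMonoid.addOrderOf_eq_one_iff]
  have hpos : 0 < addOrderOf δ := addOrderOf_pos δ
  have hQ : 0 < Nat.card (G ⧸ AddSubgroup.zmultiples δ) := Nat.card_pos
  obtain ⟨q, hqp, hqd⟩ := Nat.exists_prime_and_dvd hne
  have h1 := hq q hqp (hqd.trans ⟨_, by rw [hmul, mul_comm]⟩)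
  refine ⟨?_, ?_, ⟨_, hmul⟩⟩
  · have hqo : (q : ℝ) ≤ addOrderOf δ := by exact_mod_cast Nat.le_of_dvd hpos hqd
    have h2 : 1 ≤ u ^ 2 * addOrderOf δ :=
      h1.trans (mul_le_mul_of_nonneg_left hqo (sq_nonneg u))
    rw [hmul]
    push_cast
    nlinarith [(Nat.cast_pos (α := ℝ)).2 hQ]
  · rw [hmul]
    exact lt_mul_of_one_lt_right hQ (by omega)

theorem alwaysWin_of_lt {c u : ℝ} (hc : 0 < c) (hu : 0 < u) (hu1 : u < 1)
    (hcu : 1 ≤ c ^ 2 * u * (1 - u) * Real.exp 1) {G : Type*} [AddCommGroup G] [Finite G]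
    (hq : ∀ q : ℕ, q.Prime → q ∣ Nat.card G → 1 ≤ u ^ 2 * q) {M : Set G} (h0 : (0 : G) ∈ M)
    (hM : AddSubgroup.closure M = ⊤) {k : ℕ} (hk : c * √(Nat.card G : ℝ) + 1 < k) :
    AlwaysWin M k := by
  classical
  induction hn : Nat.card G using Nat.strong_induction_on generalizing G k with
  | _ n ih =>
    subst hn
    have hk0 : 0 < k := by
      have : (0 : ℝ) < k := by
        have : 0 ≤ c * √(Nat.card G : ℝ) := by positivity
        linarith
      exact_mod_cast this
    rcases subsingleton_or_nontrivial G with hG | hG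
    · exact fun d => .done d ⟨⟨0, hk0⟩, Subsingleton.elim _ _⟩
    have := Fintype.ofFinite G
    set w : ℝ := √(Nat.card G : ℝ) with hw
    have hcard : 1 < Nat.card G := Finite.one_lt_card
    have hcard' : (1 : ℝ) < Nat.card G := by exact_mod_cast hcard
    have hw2 : w * w = Nat.card G := Real.mul_self_sqrt (by positivity)
    have hw0 : 0 < w := Real.sqrt_pos.2 (by linarith)
    have hcuw : 0 ≤ c * u * w := by positivity
    -- `a` bounds the number of unguarded nonzero moves; one more cop guards the move `0`, and the
    -- other `m` take the shifts.
    set a : ℕ := ⌊c * u * w⌋₊ with ha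
    have ha1 : (a : ℝ) ≤ c * u * w := Nat.floor_le hcuw
    have ha2 : c * u * w < a + 1 := Nat.lt_floor_add_one _
    have hpos : 0 < c * (1 - u) * w := by
      have : 0 < 1 - u := by linarith
      positivity
    have hak : a + 1 < k := by
      have : ((a + 1 : ℕ) : ℝ) < k := by push_cast; linarith
      exact_mod_cast this
    obtain ⟨m, hm⟩ : ∃ m, k = m + (a + 1) := ⟨k - (a + 1), by omega⟩
    have hm0 : 0 < m := by omega
    have hmlt : c * (1 - u) * w < m := by
      rw [hm] at hk
      push_cast at hk
      linarith
    obtain ⟨δ, hδ, hb⟩ := exists_shifts (M := M.toFinset) (by simpa using h0) m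
    set V := (M.toFinset.erase 0).filter fun s => ∀ i < m, s - δ i ∉ M.toFinset with hV
    have hVa : V.card ≤ a := by
      refine Nat.le_floor (hb.trans ?_)
      have hMc : ((M.toFinset.card : ℕ) : ℝ) ≤ Fintype.card G := by
        exact_mod_cast Finset.card_le_univ M.toFinset
      rw [Nat.card_eq_fintype_card] at hcard' hw2
      refine (mul_one_sub_div_pow_le (by linarith) hm0 (by linarith)).trans ?_
      have hm' : (0 : ℝ) < m := by exact_mod_cast hm0
      rw [div_le_iff₀ (by positivity)]
      calc (Fintype.card G : ℝ) - 1 ≤ w * w := by linarith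
        _ ≤ w * w * (c ^ 2 * u * (1 - u) * Real.exp 1) :=
            le_mul_of_one_le_right (by positivity) hcu
        _ = c * u * w * (c * (1 - u) * w * Real.exp 1) := by ring
        _ ≤ c * u * w * (m * Real.exp 1) := by gcongr
    intro d
    -- By induction `a + 2 > c u w + 1` cops win on each quotient, and `m + (a + 2) = k + 1` is just
    -- affordable.
    refine (reach_forall_mem δ (r := a + 2) (m := m) (M := M) (by omega) ?_ hk0 d).trans ?_
    · intro i hi
      obtain ⟨hle, hlt, hdvd⟩ := card_quotient_zmultiples_le hq (hδ i hi)
      refine ih _ hlt (fun q hqp hqd => hq q hqp (hqd.trans hdvd)) ?_ ?_ ?_ rfl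
      · exact ⟨0, h0, map_zero _⟩
      · rw [← AddMonoidHom.map_closure, hM]
        exact AddSubgroup.map_top_of_surjective _ (QuotientAddGroup.mk'_surjective _)
      · have hs : √(Nat.card (G ⧸ AddSubgroup.zmultiples (δ i)) : ℝ) ≤ u * w := by
          refine Real.sqrt_le_iff.2 ⟨by positivity, hle.trans_eq ?_⟩
          rw [← hw2]; ring
        have := mul_le_mul_of_nonneg_left hs hc.le
        push_cast
        linarith
    · rintro x ⟨f, hf, hx⟩
      refine reach_captured_of_mem h0 hM δ (insert 0 V) ?_ ?_ hf hx
      · intro s hs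
        by_cases hs0 : s = 0
        · left; simp [hs0]
        by_cases h : ∃ i < m, s - δ i ∈ M
        · exact Or.inr h
        · left
          push Not at h
          simp only [hV, Finset.mem_insert, Finset.mem_filter, Finset.mem_erase, Set.mem_toFinset]
          exact Or.inr ⟨⟨hs0, hs⟩, h⟩
      · have := Finset.card_insert_le (0 : G) V
        omega

theorem copNumber_cayleyDigraph_le {c u : ℝ} (hc : 0 < c) (hu : 0 < u) (hu1 : u < 1)
    (hcu : 1 ≤ c ^ 2 * u * (1 - u) * Real.exp 1) {G : Type*} [AddCommGroup G] [Finite G]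
    (hq : ∀ q : ℕ, q.Prime → q ∣ Nat.card G → 1 ≤ u ^ 2 * q) {S : Set G}
    (hS : AddSubgroup.closure S = ⊤) :
    (copNumber (cayleyDigraph G S) : ℝ) ≤ c * √(Nat.card G : ℝ) + 2 := by
  have hnn : 0 ≤ c * √(Nat.card G : ℝ) := by positivity
  have hwin : AlwaysWin (insert 0 S) (⌊c * √(Nat.card G : ℝ)⌋₊ + 2) := by
    refine alwaysWin_of_lt hc hu hu1 hcu hq (Set.mem_insert 0 S) ?_ ?_
    · rw [eq_top_iff, ← hS]
      exact AddSubgroup.closure_mono (Set.subset_insert 0 S)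
    · push_cast
      linarith [Nat.lt_floor_add_one (c * √(Nat.card G : ℝ))]
  have hle : copNumber (cayleyDigraph G S) ≤ ⌊c * √(Nat.card G : ℝ)⌋₊ + 2 :=
    Nat.sInf_le hwin.copsWin
  calc (copNumber (cayleyDigraph G S) : ℝ)
      ≤ ((⌊c * √(Nat.card G : ℝ)⌋₊ + 2 : ℕ) : ℝ) := by exact_mod_cast hle
    _ ≤ _ := by push_cast; linarith [Nat.floor_le hnn]

/-! ### Numerical constants and conclusion -/

theorem abs_sqrt_sub_le {x a ε : ℝ} (hε : ε ≤ a) (hlo : (a - ε) ^ 2 ≤ x)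
    (hhi : x ≤ (a + ε) ^ 2) (hε0 : 0 ≤ ε) : |√x - a| ≤ ε := by
  rw [abs_le]
  constructor
  · linarith [Real.le_sqrt_of_sq_le hlo]
  · linarith [Real.sqrt_le_iff.2 ⟨(by linarith : 0 ≤ a + ε), hhi⟩]

theorem two_div_sqrt_exp_one : 2 / √(Real.exp 1) = √(4 / Real.exp 1) := by
  rw [Real.sqrt_div (by norm_num), show (4 : ℝ) = 2 ^ 2 by norm_num,
    Real.sqrt_sq (by norm_num)]

theorem sqrt_three_bounds : (1.73205 : ℝ) < √3 ∧ √3 < (1.73206 : ℝ) :=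
  ⟨Real.lt_sqrt_of_sq_lt (by norm_num), (Real.sqrt_lt' (by norm_num)).2 (by norm_num)⟩

end CopsRobbers

theorem corollary20 {G : Type*} [AddCommGroup G] [Finite G] (S : Set G) (hS0 : (0 : G) ∉ S)
    (hS : AddSubgroup.closure S = ⊤) (p : ℕ)
    (hp : IsLeast {q : ℕ | q.Prime ∧ q ∣ Nat.card G} p) :
    (p = 3 →
      (CopsRobbers.copNumber (CopsRobbers.cayleyDigraph G S) : ℝ) ≤
          √(3 / ((√3 - 1) * Real.exp 1)) * √(Nat.card G : ℝ) + 2 ∧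
        |√(3 / ((√3 - 1) * Real.exp 1)) - 1.2278| ≤ 0.00005) ∧
    (5 ≤ p →
      (CopsRobbers.copNumber (CopsRobbers.cayleyDigraph G S) : ℝ) ≤
          2 / √(Real.exp 1) * √(Nat.card G : ℝ) + 2 ∧
        |2 / √(Real.exp 1) - 1.2131| ≤ 0.00005) := by
  have he1 := Real.exp_one_gt_d9
  have he2 := Real.exp_one_lt_d9
  have he0 := Real.exp_pos 1
  have hmin : ∀ q : ℕ, q.Prime → q ∣ Nat.card G → (p : ℝ) ≤ q := fun q h1 h2 => by
    exact_mod_cast hp.2 ⟨h1, h2⟩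
  obtain ⟨h31, h32⟩ := CopsRobbers.sqrt_three_bounds
  have h3sq : √3 * √3 = 3 := Real.mul_self_sqrt (by norm_num)
  refine ⟨fun h => ⟨?_, ?_⟩, fun h => ⟨?_, ?_⟩⟩
  · have hpos : 0 < 3 / ((√3 - 1) * Real.exp 1) := by
      have : 0 < √3 - 1 := by linarith
      positivity
    -- The least `u` with `3 u² ≥ 1`; the constant makes `c² u (1 - u) e` equal to `1`.
    refine CopsRobbers.copNumber_cayleyDigraph_le (u := 1 / √3) (Real.sqrt_pos.2 hpos)
      (by positivity) ?_ ?_ ?_ hS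
    · rw [div_lt_one (by linarith)]; linarith
    · rw [Real.sq_sqrt hpos.le]
      have h1 : √3 - 1 ≠ 0 := by linarith
      have h2 : √3 ≠ 0 := by linarith
      refine le_of_eq ?_
      field_simp
      linarith
    · intro q h1 h2
      have := hmin q h1 h2
      rw [h] at this
      rw [div_pow, Real.sq_sqrt (by norm_num)]
      push_cast at this
      linarith
  · have hd : 0 < (√3 - 1) * Real.exp 1 := mul_pos (by linarith) he0
    refine CopsRobbers.abs_sqrt_sub_le (by norm_num) ?_ ?_ (by norm_num)
    · rw [le_div_iff₀ hd]
      have : (√3 - 1) * Real.exp 1 ≤ 0.73206 * 2.7182818286 :=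
        mul_le_mul (by linarith) he2.le he0.le (by norm_num)
      nlinarith
    · rw [div_le_iff₀ hd]
      have : 0.73205 * 2.7182818283 ≤ (√3 - 1) * Real.exp 1 :=
        mul_le_mul (by linarith) he1.le (by norm_num) (by linarith)
      nlinarith
  -- `u = 1/2` maximises `u (1 - u)` and only requires prime factors at least `4`.
  · refine CopsRobbers.copNumber_cayleyDigraph_le (u := 1 / 2) (by positivity)
      (by norm_num) (by norm_num) ?_ ?_ hS
    · rw [div_pow, Real.sq_sqrt he0.le]
      refine le_of_eq ?_
      field_simp
      norm_num
    · intro q h1 h2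
      have := hmin q h1 h2
      have h5 : (5 : ℝ) ≤ p := by exact_mod_cast h
      linarith
  · rw [CopsRobbers.two_div_sqrt_exp_one]
    refine CopsRobbers.abs_sqrt_sub_le (by norm_num) ?_ ?_ (by norm_num)
    · rw [le_div_iff₀ he0]
      nlinarith
    · rw [div_le_iff₀ he0]
      nlinarith
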